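/- **Setting.** Let $K\ge 2$, $S\ge 0$ and $N=K^S$ be integers (so $S=\log_K N$), and let $\bar\phi_u=2\pi u/N$, $u=0,\dots,N-1$, be the angular grid. A base station (BS) with $N_{BS}$ antennas and a mobile station (MS) with $N_{MS}$ antennas have arbitrary array responses $a_{BS}(\phi)\in\mathbb C^{N_{BS}}$, $a_{MS}(\theta)\in\mathbb C^{N_{MS}}$. The single-path channel is $$H=\sqrt{N_{BS}N_{MS}/\rho}\;\alpha\,a_{MS}(\theta)\,a_{BS}(\phi)^H,\qquad \rho>0,\quad \alpha\sim\mathcal{CN}(0,\bar P_R),$$ with angle of departure (AoD) $\phi=\bar\phi_u$ and angle of arrival (AoA) $\theta=\bar\phi_v$ on the grid; $d=(u,v)$ is called the direction. **Codebooks.** At each stage $s=1,\dots,S$ and for each $k=1,\dots,K^{s-1}$, the BS has a matrix $F_{(s,k)}$ and the MS a matrix $W_{(s,k)}$, each with $K$ unit-norm columns (beams). Beam $m$ of subset $k$ is assigned the set of grid indices $$I_{(s,k,m)}=\Big\{u:\ \tfrac{N}{K^s}(K(k-1)+m-1)\le u<\tfrac N{K^s}(K(k-1)+m)\Big\}.$$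 $G_{(s,k)}$ is the $N\times K$ zero-one matrix whose column $m$ is the indicator of $I_{(s,k,m)}$. With $A_{BS,D}$, $A_{MS,D}$ the matrices whose columns are the array responses at the grid points, and constants $C^{BS}_s,C^{MS}_s\ge 0$, let $E^{BS}_{(s,k)}=A_{BS,D}^HF_{(s,k)}-C_s^{BS}G_{(s,k)}$ and $E^{MS}_{(s,k)}=A_{MS,D}^HW_{(s,k)}-C_s^{MS}G_{(s,k)}$. For a pair $(k_B,k_M)$ of subsets let $\mathbf G=G_{(s,k_B)}^T\otimes G_{(s,k_M)}^T$ and $$\mathbf E=(E^{BS}_{(s,k_B)})^T\otimes (E^{MS}_{(s,k_M)})^T+(E^{BS}_{(s,k_B)})^T\otimes C^{MS}_sG_{(s,k_M)}^T+C^{BS}_sG_{(s,k_B)}^T\otimes (E^{MS}_{(s,k_M)})^T .$$ Rows of $\mathbf G,\mathbf E$ are beam pairs and columns are directions. If $\mathbf G_{m,d}=1$, the forward gain is $G^F_{(s,k_B,k_M,d)}=\big|\sqrt{G_{(s)}}+\sqrt{N_{BS}N_{MS}}\,\mathbf E_{m,d}\big|^2$ with $G_{(s)}=N_{BS}(C_s^{BS})^2N_{MS}(C_s^{MS})^2$.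 If $\mathbf G_{\bar m,d}=0$, the backward gain is $G^B_{(s,k_B,k_M,d,\bar m)}=N_{BS}N_{MS}|\mathbf E_{\bar m,d}|^2$. Let $\beta_{(s,k_B,k_M,d,\bar m)}=G^F_{(s,k_B,k_M,d)}/G^B_{(s,k_B,k_M,d,\bar m)}\in[0,\infty]$, with value $0$ if $G^F=0$ and $\infty$ if only $G^B=0$. **Algorithm.** Start with $k_1^{BS}=k_1^{MS}=1$. At stage $s=1,\dots,S$, with training power $P_s\ge 0$, the MS obtains for every beam pair $(m_B,m_M)$ the measurement $$y_{m_B,m_M}=\sqrt{P_s}\,w^HHf+w^H n_{s,m_B,m_M},\qquad f=[F_{(s,k_s^{BS})}]_{:,m_B},\quad w=[W_{(s,k_s^{MS})}]_{:,m_M}.$$ It selects a pair $(m_B^\star,m_M^\star)$ of maximal $|y_{m_B,m_M}|^2$ (ties resolved arbitrarily) and sets $k^{BS}_{s+1}=K(k_s^{BS}-1)+m_B^\star$, $k^{MS}_{s+1}=K(k_s^{MS}-1)+m_M^\star$. After stage $S$ the estimates are $\hat\phi=\bar\phi_{k^{BS}_{S+1}-1}$, $\hat\theta=\bar\phi_{k^{MS}_{S+1}-1}$.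 The entries of all noise vectors $n_{s,m_B,m_M}\in\mathbb C^{N_{MS}}$ are i.i.d. circularly symmetric complex Gaussian, centred, and independent of $\alpha$. Their mean power is either $\sigma^2$ (total variance $\sigma^2$) or $2\sigma^2$ (variance $\sigma^2$ per real dimension), where $\sigma>0$; the claim holds in both conventions. Let $\bar\gamma=\bar P_R/(\rho\sigma^2)$. **Theorem.** For every true direction $d=(u,v)$, the error probability $\bar p=\Pr\big((\hat\phi,\hat\theta)\ne(\phi,\theta)\big)$, averaged over the path gain and the noise, satisfies $$\bar p\ \le\ \frac{K^2-1}{2}\sum_{s=1}^{S}\left(1-\frac{\left(1-\frac1{\beta_s}\right)P_sG^F_s\bar\gamma}{4\sqrt{1+\frac12\left(1+\frac1{\beta_s}\right)P_sG^F_s\bar\gamma+\frac1{16}P_s^2(G^F_s)^2\bar\gamma^2\left(1-\frac1{\beta_s}\right)^2}}\right)$$ in each of the following two cases: 1. $\beta_s$ is the minimum of $\beta_{(s,k_B,k_M,d',\bar m)}$ over all $k_B,k_M\in\{1,\dots,K^{s-1}\}$, all directions $d'$ in the ranges of these subsets, and all beam pairs $\bar m$ with $\mathbf G_{\bar m,d'}=0$;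 and $G^F_s$ is the minimum of the forward gains $G^F_{(s,k_B,k_M,d')}$ over the same $k_B,k_M,d'$. 2. The same minima are taken over the true direction $d'=d$ only; that is, $G^F_s$ is the forward gain in direction $d$ at stage $s$, and $\beta_s$ is the smallest ratio of this forward gain to a backward gain in direction $d$. If $G^F_s=0$, the $s$-th summand is read as $1$. -/

import Mathlib

open MeasureTheory ProbabilityTheory
open scoped ENNReal NNReal Kronecker Matrix

noncomputable section

namespace MmWave

/-- The circularly symmetric complex Gaussian law `CN(0, v)`: independent centred real and
imaginary parts of variance `v / 2` each, so that the mean of `|z|²` is `v`. -/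
def complexGaussian (v : ℝ≥0) : Measure ℂ :=
  ((gaussianReal 0 (v / 2)).prod (gaussianReal 0 (v / 2))).map
    (fun p : ℝ × ℝ => (p.1 : ℂ) + (p.2 : ℂ) * Complex.I)

/-- The `u`-th point `2πu/N` of the uniform angular grid. -/
def gridAngle (N : ℕ) (u : ℕ) : ℝ := 2 * Real.pi * u / N

/-- A hierarchical codebook for an array of `n` antennas. Stages, subsets and beams are counted
from `0`: level `s` has the subsets `k < K ^ s` (the values at other `k` are never used), and the
columns of `mat s k` are the `K` unit-norm beamforming vectors of subset `k`. `C s` is the nominal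
projection of a beam on the array responses inside its sub-range. -/
structure Codebook (n K S : ℕ) where
  mat : Fin S → ℕ → Matrix (Fin n) (Fin K) ℂ
  C : Fin S → ℝ
  C_nonneg : ∀ s, 0 ≤ C s
  unit_norm : ∀ (s : Fin S) (k : ℕ) (m : Fin K), k < K ^ (s : ℕ) →
    ∑ i, ‖mat s k i m‖ ^ 2 = 1

/-- The grid point `u` lies in the sub-range of beam `m` of subset `k` at level `s`. -/
def InSubrange (N K s k m u : ℕ) : Prop :=
  N / K ^ (s + 1) * (K * k + m) ≤ u ∧ u < N / K ^ (s + 1) * (K * k + m + 1)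

open Classical in
/-- The `N × K` zero-one matrix of the ideal beam patterns. -/
def patternMatrix (N K s k : ℕ) : Matrix (Fin N) (Fin K) ℂ :=
  Matrix.of fun u m => if InSubrange N K s k m u then 1 else 0

/-- The dictionary whose columns are the array responses at the grid angles. -/
def dictionary {n : ℕ} (N : ℕ) (a : ℝ → Fin n → ℂ) : Matrix (Fin n) (Fin N) ℂ :=
  Matrix.of fun i u => a (gridAngle N u) i

/-- The error matrix `A_Dᴴ F_(s,k) - C_s G_(s,k)` of one codebook. -/
def errorMatrix {n K S : ℕ} (N : ℕ) (a : ℝ → Fin n → ℂ) (F : Codebook n K S)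
    (s : Fin S) (k : ℕ) : Matrix (Fin N) (Fin K) ℂ :=
  (dictionary N a)ᴴ * F.mat s k - (F.C s : ℂ) • patternMatrix N K s k

/-- A precoder/combiner pair `(m_BS, m_MS)`. -/
abbrev BeamPair (K : ℕ) := Fin K × Fin K

/-- A quantized direction: grid indices of the AoD and of the AoA. -/
abbrev Direction (N : ℕ) := Fin N × Fin N

/-- The joint `K² × N²` pattern matrix of the subsets `kB`, `kM` at level `s`. -/
def jointPattern (N K s kB kM : ℕ) : Matrix (BeamPair K) (Direction N) ℂ :=
  (patternMatrix N K s kB)ᵀ ⊗ₖ (patternMatrix N K s kM)ᵀ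

section System

variable {nB nM K S : ℕ}

/-- The joint `K² × N²` error matrix of the subsets `kB`, `kM` at level `s`. -/
def jointError (N : ℕ) (aB : ℝ → Fin nB → ℂ) (aM : ℝ → Fin nM → ℂ)
    (F : Codebook nB K S) (W : Codebook nM K S) (s : Fin S) (kB kM : ℕ) :
    Matrix (BeamPair K) (Direction N) ℂ :=
  (errorMatrix N aB F s kB)ᵀ ⊗ₖ (errorMatrix N aM W s kM)ᵀ
    + (errorMatrix N aB F s kB)ᵀ ⊗ₖ ((W.C s : ℂ) • (patternMatrix N K s kM)ᵀ)
    + ((F.C s : ℂ) • (patternMatrix N K s kB)ᵀ) ⊗ₖ (errorMatrix N aM W s kM)ᵀ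

/-- The nominal training beamforming gain `G_(s) = (N_BS C_BS²) (N_MS C_MS²)`. -/
def nominalGain (F : Codebook nB K S) (W : Codebook nM K S) (s : Fin S) : ℝ :=
  ((nB : ℝ) * F.C s ^ 2) * ((nM : ℝ) * W.C s ^ 2)

/-- The forward gain in direction `d`; used for the pair `m` whose main lobe contains `d`. -/
def forwardGain (N : ℕ) (aB : ℝ → Fin nB → ℂ) (aM : ℝ → Fin nM → ℂ)
    (F : Codebook nB K S) (W : Codebook nM K S) (s : Fin S) (kB kM : ℕ)
    (m : BeamPair K) (d : Direction N) : ℝ :=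
  ‖(Real.sqrt (nominalGain F W s) : ℂ)
    + (Real.sqrt ((nB : ℝ) * nM) : ℂ) * jointError N aB aM F W s kB kM m d‖ ^ 2

/-- The backward gain in direction `d`; used for pairs `m` whose main lobe does not contain `d`. -/
def backwardGain (N : ℕ) (aB : ℝ → Fin nB → ℂ) (aM : ℝ → Fin nM → ℂ)
    (F : Codebook nB K S) (W : Codebook nM K S) (s : Fin S) (kB kM : ℕ)
    (m : BeamPair K) (d : Direction N) : ℝ :=
  (nB : ℝ) * nM * ‖jointError N aB aM F W s kB kM m d‖ ^ 2

/-- The smallest forward-to-backward ratio at stage `s` over all subsets, all directions `d ∈ D`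
and all pairs `m'` whose main lobe misses `d`, where `m` is the pair whose main lobe contains `d`.
The ratio is `∞` if only the backward gain vanishes, and `0` if the forward gain vanishes. -/
def worstRatio (N : ℕ) (aB : ℝ → Fin nB → ℂ) (aM : ℝ → Fin nM → ℂ)
    (F : Codebook nB K S) (W : Codebook nM K S) (D : Set (Direction N)) (s : Fin S) : ℝ≥0∞ :=
  sInf {r | ∃ kB < K ^ (s : ℕ), ∃ kM < K ^ (s : ℕ), ∃ d ∈ D, ∃ m m' : BeamPair K,
    jointPattern N K s kB kM m d = 1 ∧ jointPattern N K s kB kM m' d = 0 ∧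
    r = ENNReal.ofReal (forwardGain N aB aM F W s kB kM m d) /
      ENNReal.ofReal (backwardGain N aB aM F W s kB kM m' d)}

/-- The smallest forward gain at stage `s` over all subsets and all directions `d ∈ D`. -/
def worstForwardGain (N : ℕ) (aB : ℝ → Fin nB → ℂ) (aM : ℝ → Fin nM → ℂ)
    (F : Codebook nB K S) (W : Codebook nM K S) (D : Set (Direction N)) (s : Fin S) : ℝ :=
  sInf {g | ∃ kB < K ^ (s : ℕ), ∃ kM < K ^ (s : ℕ), ∃ d ∈ D, ∃ m : BeamPair K,
    jointPattern N K s kB kM m d = 1 ∧ g = forwardGain N aB aM F W s kB kM m d}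

/-- The single-path channel `√(N_BS N_MS / ρ) α a_MS(θ) a_BS(φ)ᴴ`. -/
def channel (aB : ℝ → Fin nB → ℂ) (aM : ℝ → Fin nM → ℂ) (ρ : ℝ) (α : ℂ) (φ θ : ℝ) :
    Matrix (Fin nM) (Fin nB) ℂ :=
  ((Real.sqrt ((nB : ℝ) * nM / ρ) : ℂ) * α) • Matrix.vecMulVec (aM θ) (star (aB φ))

/-- The indices of the scalar noise samples: stage, precoder, combiner, receive antenna. A fresh
noise vector corrupts each precoder/combiner measurement. -/
abbrev NoiseIndex (S K nM : ℕ) := Fin S × Fin K × Fin K × Fin nM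

/-- The received signals of stage `s` when the subsets `kB` and `kM` are in use:
`y = √P_s wᴴ H f + wᴴ n` for each precoder/combiner pair. -/
def received (F : Codebook nB K S) (W : Codebook nM K S) (P : Fin S → ℝ)
    (H : Matrix (Fin nM) (Fin nB) ℂ) (noise : NoiseIndex S K nM → ℂ)
    (s : Fin S) (kB kM : ℕ) (m : BeamPair K) : ℂ :=
  (Real.sqrt (P s) : ℂ) * ((W.mat s kM)ᴴ * H * F.mat s kB) m.2 m.1
    + ∑ i, star (W.mat s kM i m.2) * noise (s, m.1, m.2, i)

/-- A rule that picks a pair of maximal received power; ties are resolved in any way. -/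
def IsArgmaxRule (sel : (BeamPair K → ℂ) → BeamPair K) : Prop :=
  ∀ (Y : BeamPair K → ℂ) (m : BeamPair K), ‖Y m‖ ^ 2 ≤ ‖Y (sel Y)‖ ^ 2

/-- The adaptive search: the pair of subset indices in use before each stage and, at
`Fin.last S`, the pair of grid indices that is the outcome. It starts from subset `0` on both
sides; beam `m` of subset `k` leads to subset `K k + m` of the next level. -/
def search (sel : (BeamPair K → ℂ) → BeamPair K) (F : Codebook nB K S) (W : Codebook nM K S)
    (P : Fin S → ℝ) (H : Matrix (Fin nM) (Fin nB) ℂ) (noise : NoiseIndex S K nM → ℂ) :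
    Fin (S + 1) → ℕ × ℕ :=
  Fin.induction (motive := fun _ => ℕ × ℕ) (0, 0) fun s k =>
    let m := sel (received F W P H noise s k.1 k.2)
    (K * k.1 + m.1, K * k.2 + m.2)

/-- The estimated AoD and AoA. -/
def estimate (N : ℕ) (sel : (BeamPair K → ℂ) → BeamPair K) (F : Codebook nB K S)
    (W : Codebook nM K S) (P : Fin S → ℝ) (H : Matrix (Fin nM) (Fin nB) ℂ)
    (noise : NoiseIndex S K nM → ℂ) : ℝ × ℝ :=
  (gridAngle N (search sel F W P H noise (Fin.last S)).1,
    gridAngle N (search sel F W P H noise (Fin.last S)).2)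

end System

/-- The summand of the bound, with `x = P_s G^F_s γ̄`. If `β = ∞`, then `1/β = 0`. (If `β = 0`, a
forward gain vanishes; the worst forward gain and hence `x` are then `0`, and the summand is `1`.) -/
def stageTerm (β : ℝ≥0∞) (x : ℝ) : ℝ :=
  1 - (1 - (β⁻¹).toReal) * x /
    (4 * Real.sqrt (1 + 1 / 2 * (1 + (β⁻¹).toReal) * x
      + 1 / 16 * x ^ 2 * (1 - (β⁻¹).toReal) ^ 2))

/-- `((K² - 1) / 2) ∑ₛ stageTerm β_s (P_s G^F_s γ̄)`. -/
def errorBound {S : ℕ} (K : ℕ) (P : Fin S → ℝ) (γ : ℝ) (β : Fin S → ℝ≥0∞) (GF : Fin S → ℝ) : ℝ :=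
  ((K : ℝ) ^ 2 - 1) / 2 * ∑ s, stageTerm (β s) (P s * GF s * γ)

end MmWave

end

/-! The squared modulus of a circularly symmetric complex Gaussian is exponentially distributed. Two
jointly circular Gaussians `X`, `Y` are generally correlated, but a hyperbolic rotation
`(X + q Y, q̄ X + Y)` multiplies `|X|² - |Y|²` by the constant `1 - |q|²`, and for a suitable `q` it
decorrelates the pair. This turns `|X| ≤ |Y|` into a comparison of two independent exponential
variables and gives the exact probability that one beam pair beats another.

As long as no error occurs, the search visits the subsets whose ranges contain the true direction,
so an error forces one of the `K² - 1` wrong beam pairs to win a stage along this path; the union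
bound sums their probabilities. The pairwise error probability decreases in the forward gain and
increases in the leakage `1 / β`, which allows the gains to be replaced by their worst cases, and
both noise conventions are covered by halving the signal-to-noise ratio `P_s G γ̄`. If the worst
ratio of a stage is at most `1`, then the summand of that stage is at least `1` and the bound is
trivial. -/

noncomputable section

namespace MmWave

/-! ### Exponential laws -/

lemma measurable_exponentialPDF (r : ℝ) : Measurable (exponentialPDF r) :=
  (measurable_exponentialPDFReal r).ennreal_ofReal

lemma expMeasure_eq_withDensity (r : ℝ) :
    expMeasure r = volume.withDensity (exponentialPDF r) :=
  rfl

lemma expMeasure_Ici {r x : ℝ} (hr : 0 < r) (hx : 0 ≤ x) :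
    expMeasure r (Set.Ici x) = ENNReal.ofReal (Real.exp (-(r * x))) := by
  have := isProbabilityMeasure_expMeasure hr
  have : NullSingletonClass (expMeasure r) := nullSingletonClass_withDensity _
  rw [← measure_congr Ioi_ae_eq_Ici, ← Set.compl_Iic, prob_compl_eq_one_sub measurableSet_Iic,
    ← ofReal_cdf, cdf_expMeasure_eq hr, if_pos hx, ← ENNReal.ofReal_one,
    ← ENNReal.ofReal_sub _ (by simpa using by positivity), sub_sub_cancel]

lemma expMeasure_prod_le {a b : ℝ} (ha : 0 < a) (hb : 0 < b) :
    (expMeasure a).prod (expMeasure b) {p | p.1 ≤ p.2} = ENNReal.ofReal (a / (a + b)) := by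
  have := isProbabilityMeasure_expMeasure hb
  have hpdf (x : ℝ) : exponentialPDF a x * expMeasure b (Set.Ici x) =
      ENNReal.ofReal (a / (a + b)) * exponentialPDF (a + b) x := by
    obtain hx | hx := lt_or_ge x 0
    · rw [exponentialPDF_of_neg hx, exponentialPDF_of_neg hx, zero_mul, mul_zero]
    · have hexp : -((a + b) * x) = -(a * x) + -(b * x) := by ring
      rw [expMeasure_Ici hb hx, exponentialPDF_of_nonneg hx, exponentialPDF_of_nonneg hx,
        ← ENNReal.ofReal_mul (by positivity), ← ENNReal.ofReal_mul (by positivity), hexp,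
        Real.exp_add]
      congr 1
      field_simp
  calc (expMeasure a).prod (expMeasure b) {p | p.1 ≤ p.2}
      = ∫⁻ x, expMeasure b (Set.Ici x) ∂expMeasure a :=
        Measure.prod_apply (measurableSet_le measurable_fst measurable_snd)
    _ = ∫⁻ x, exponentialPDF a x * expMeasure b (Set.Ici x) :=
        lintegral_withDensity_eq_lintegral_mul_non_measurable _ (measurable_exponentialPDF a)
          (ae_of_all _ fun _ => ENNReal.ofReal_lt_top) _
    _ = ENNReal.ofReal (a / (a + b)) := by
        simp_rw [hpdf]
        rw [lintegral_const_mul _ (measurable_exponentialPDF _),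
          lintegral_exponentialPDF_eq_one (by positivity), mul_one]

lemma charFun_expMeasure {r : ℝ} (hr : 0 < r) (t : ℝ) :
    charFun (expMeasure r) t = r / (r - t * Complex.I) := by
  have hre : (t * Complex.I - r).re < 0 := by simpa using hr
  have hpdf (x : ℝ) : (exponentialPDF r x).toReal • Complex.exp (t * x * Complex.I) =
      (Set.Ici 0).indicator (fun x : ℝ => r * Complex.exp ((t * Complex.I - r) * x)) x := by
    obtain hx | hx := lt_or_ge x 0
    · rw [exponentialPDF_of_neg hx, Set.indicator_of_notMem (by simpa using hx)]
      simp
    · rw [exponentialPDF_of_nonneg hx, Set.indicator_of_mem (by simpa using hx),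
        ENNReal.toReal_ofReal (by positivity), Complex.real_smul, Complex.ofReal_mul,
        Complex.ofReal_exp, mul_assoc, ← Complex.exp_add]
      congr 2
      push_cast
      ring
  rw [charFun_apply_real, expMeasure_eq_withDensity,
    integral_withDensity_eq_integral_toReal_smul (measurable_exponentialPDF r)
      (ae_of_all _ fun _ => ENNReal.ofReal_lt_top)]
  simp_rw [hpdf]
  rw [integral_indicator measurableSet_Ici, integral_Ici_eq_integral_Ioi, integral_const_mul,
    integral_exp_mul_complex_Ioi hre, Complex.ofReal_zero, mul_zero, Complex.exp_zero,
    ← neg_sub (r : ℂ), neg_div_neg_eq, mul_one_div]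

/-! ### The circularly symmetric complex Gaussian law -/

instance isProbabilityMeasure_complexGaussian (v : ℝ≥0) :
    IsProbabilityMeasure (complexGaussian v) :=
  Measure.isProbabilityMeasure_map (by fun_prop)

lemma charFun_complexGaussian (v : ℝ≥0) (t : ℂ) :
    charFun (complexGaussian v) t = Complex.exp (-(v * ‖t‖ ^ 2 / 4 : ℝ)) := by
  have hcoord (x : ℝ) : ∫ y, Complex.exp (x * y * Complex.I) ∂gaussianReal 0 (v / 2) =
      Complex.exp (-(v * x ^ 2 / 4 : ℝ)) := by
    rw [← charFun_apply_real, charFun_gaussianReal]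
    congr 1
    push_cast
    ring
  have hsplit (p : ℝ × ℝ) :
      Complex.exp ((inner ℝ ((p.1 : ℂ) + p.2 * Complex.I) t : ℝ) * Complex.I) =
        Complex.exp (t.re * p.1 * Complex.I) * Complex.exp (t.im * p.2 * Complex.I) := by
    rw [← Complex.exp_add, Complex.inner]
    congr 1
    simp
    ring
  rw [charFun_apply, complexGaussian, integral_map (by fun_prop) (by fun_prop)]
  simp_rw [hsplit]
  rw [integral_prod_mul (fun x : ℝ => Complex.exp (t.re * x * Complex.I))
    (fun y : ℝ => Complex.exp (t.im * y * Complex.I)), hcoord, hcoord, ← Complex.exp_add,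
    ← Complex.normSq_eq_norm_sq, Complex.normSq_apply]
  congr 1
  push_cast
  ring

lemma integral_cexp_mul_sq_gaussianReal_sq {v : ℝ≥0} (hv : v ≠ 0) {z : ℂ} (hz : z.re ≤ 0) :
    (∫ x : ℝ, Complex.exp (z * x ^ 2) ∂gaussianReal 0 v) ^ 2 = 1 / (1 - 2 * v * z) := by
  have : (0 : ℝ) < v := by positivity
  set b : ℂ := (2 * v : ℂ)⁻¹ - z with hb
  have hbv : 2 * v * b = 1 - 2 * v * z := by
    have : (v : ℂ) ≠ 0 := by simpa using hv
    rw [hb]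
    field_simp
  have hre : 0 < b.re := by
    have : ((2 * v : ℂ)⁻¹).re = (2 * v : ℝ)⁻¹ := by
      rw [← Complex.ofReal_re (2 * v : ℝ)⁻¹]
      push_cast
      rfl
    rw [hb, Complex.sub_re, this]
    have : 0 < (2 * v : ℝ)⁻¹ := by positivity
    linarith
  have hpdf (x : ℝ) : gaussianPDFReal 0 v x • Complex.exp (z * x ^ 2) =
      ((√(2 * Real.pi * v))⁻¹ : ℝ) * Complex.exp (-b * x ^ 2) := by
    rw [gaussianPDFReal, Complex.real_smul, Complex.ofReal_mul, mul_assoc, Complex.ofReal_exp,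
      ← Complex.exp_add]
    congr 2
    push_cast
    rw [hb]
    ring
  rw [integral_gaussianReal_eq_integral_smul hv]
  simp_rw [hpdf]
  rw [integral_const_mul, integral_gaussian_complex hre, mul_pow, one_div,
    Complex.cpow_ofNat_inv_pow, ← Complex.ofReal_pow, inv_pow, Real.sq_sqrt (by positivity), ← hbv]
  have : (v : ℂ) ≠ 0 := by simpa using hv
  have : b ≠ 0 := fun h => by simp [h] at hre
  push_cast
  field_simp

lemma map_norm_sq_complexGaussian {v : ℝ≥0} (hv : v ≠ 0) :
    (complexGaussian v).map (fun z => ‖z‖ ^ 2) = expMeasure (v : ℝ)⁻¹ := by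
  have hv0 : (0 : ℝ) < v := by positivity
  have := isProbabilityMeasure_expMeasure (inv_pos.2 hv0)
  have : IsProbabilityMeasure ((complexGaussian v).map (fun z => ‖z‖ ^ 2)) :=
    Measure.isProbabilityMeasure_map (by fun_prop)
  refine Measure.ext_of_charFun (funext fun t => ?_)
  have hsplit (p : ℝ × ℝ) :
      Complex.exp (t * (‖(p.1 : ℂ) + p.2 * Complex.I‖ ^ 2 : ℝ) * Complex.I) =
        Complex.exp (t * Complex.I * p.1 ^ 2) * Complex.exp (t * Complex.I * p.2 ^ 2) := by
    rw [← Complex.exp_add, ← Complex.normSq_eq_norm_sq, Complex.normSq_add_mul_I]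
    congr 1
    push_cast
    ring
  rw [charFun_apply_real, integral_map (by fun_prop) (by fun_prop), complexGaussian,
    integral_map (by fun_prop) (by fun_prop)]
  simp_rw [hsplit]
  rw [integral_prod_mul (fun x : ℝ => Complex.exp (t * Complex.I * x ^ 2))
    (fun y : ℝ => Complex.exp (t * Complex.I * y ^ 2)), ← sq,
    integral_cexp_mul_sq_gaussianReal_sq (by positivity) (by simp),
    charFun_expMeasure (inv_pos.2 hv0)]
  have : (v : ℂ) ≠ 0 := by simpa using hv
  push_cast
  field_simp

lemma complexGaussian_prod_norm_le {a b : ℝ≥0} (ha : a ≠ 0) (hb : b ≠ 0) :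
    ((complexGaussian a).prod (complexGaussian b)) {p | ‖p.1‖ ≤ ‖p.2‖} =
      ENNReal.ofReal (b / (a + b)) := by
  have ha0 : (0 : ℝ) < a := by positivity
  have hb0 : (0 : ℝ) < b := by positivity
  have hsq : {p : ℂ × ℂ | ‖p.1‖ ≤ ‖p.2‖} =
      Prod.map (fun z => ‖z‖ ^ 2) (fun z => ‖z‖ ^ 2) ⁻¹' {p : ℝ × ℝ | p.1 ≤ p.2} := by
    ext p
    simp [sq_le_sq₀]
  rw [hsq, ← Measure.map_apply (by fun_prop) (measurableSet_le measurable_fst measurable_snd),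
    ← Measure.map_prod_map _ _ (by fun_prop) (by fun_prop), map_norm_sq_complexGaussian ha,
    map_norm_sq_complexGaussian hb, expMeasure_prod_le (inv_pos.2 ha0) (inv_pos.2 hb0)]
  congr 1
  field_simp
  ring

lemma complexGaussian_map_const_mul (v : ℝ≥0) (c : ℂ) :
    (complexGaussian v).map (fun z => c * z) = complexGaussian (v * ‖c‖₊ ^ 2) := by
  have : IsProbabilityMeasure ((complexGaussian v).map (fun z => c * z)) :=
    Measure.isProbabilityMeasure_map (by fun_prop)
  refine Measure.ext_of_charFun (funext fun t => ?_)
  have hadj : charFun ((complexGaussian v).map (fun z => c * z)) t =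
      charFun (complexGaussian v) (star c * t) := by
    rw [charFun_apply, charFun_apply, integral_map (by fun_prop) (by fun_prop)]
    congr 1 with z
    congr 3
    simp only [Complex.inner, map_mul, RCLike.star_def]
    congr 1
    ring
  rw [hadj, charFun_complexGaussian, charFun_complexGaussian]
  simp only [norm_mul, norm_star, NNReal.coe_mul, NNReal.coe_pow, coe_nnnorm]
  congr 3
  ring

/-! ### Jointly circular Gaussian pairs -/

section CircularPair

variable {Ω : Type*} [MeasurableSpace Ω] {μ : Measure Ω} {X Y : Ω → ℂ} {a b : ℝ} {c : ℂ}

/-- `X` and `Y` are jointly circularly symmetric complex Gaussian, with second moments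
`E|X|² = a`, `E|Y|² = b` and `E[X Ȳ] = c`. The joint law is prescribed through its characteristic
function, written as the mean of `exp (i Re (s X + t Y))`. -/
structure IsCircularGaussianPair (X Y : Ω → ℂ) (a b : ℝ) (c : ℂ) (μ : Measure Ω) : Prop where
  aemeasurable_fst : AEMeasurable X μ
  aemeasurable_snd : AEMeasurable Y μ
  integral_cexp (s t : ℂ) : ∫ ω, Complex.exp ((s * X ω + t * Y ω).re * Complex.I) ∂μ =
    Complex.exp (-((a * ‖s‖ ^ 2 + b * ‖t‖ ^ 2 + 2 * (s * star t * c).re) / 4 : ℝ))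

lemma IsCircularGaussianPair.linear_combination (h : IsCircularGaussianPair X Y a b c μ)
    (p q r u : ℂ) :
    IsCircularGaussianPair (fun ω => p * X ω + q * Y ω) (fun ω => r * X ω + u * Y ω)
      (a * ‖p‖ ^ 2 + b * ‖q‖ ^ 2 + 2 * (p * star q * c).re)
      (a * ‖r‖ ^ 2 + b * ‖u‖ ^ 2 + 2 * (r * star u * c).re)
      (a * (p * star r) + b * (q * star u) + p * star u * c + q * star r * star c) μ where
  aemeasurable_fst := (h.aemeasurable_fst.const_mul p).add (h.aemeasurable_snd.const_mul q)
  aemeasurable_snd := (h.aemeasurable_fst.const_mul r).add (h.aemeasurable_snd.const_mul u)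
  integral_cexp s t := by
    convert h.integral_cexp (s * p + t * r) (s * q + t * u) using 1
    · congr 1 with ω
      congr 3
      ring_nf
    · congr 3
      simp only [← Complex.normSq_eq_norm_sq, Complex.normSq_apply]
      simp
      ring

lemma IsCircularGaussianPair.map_eq_prod [IsProbabilityMeasure μ] {a b : ℝ≥0}
    (h : IsCircularGaussianPair X Y a b 0 μ) :
    μ.map (fun ω => (X ω, Y ω)) = (complexGaussian a).prod (complexGaussian b) := by
  have hX := h.aemeasurable_fst
  have hY := h.aemeasurable_snd
  have : IsProbabilityMeasure (μ.map (fun ω => (X ω, Y ω))) :=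
    Measure.isProbabilityMeasure_map (by fun_prop)
  refine charFun_eq_prod_iff.1 fun t => ?_
  rw [charFun_apply, integral_map (by fun_prop) (by fun_prop),
    integral_map (by fun_prop) (by fun_prop), charFun_complexGaussian, charFun_complexGaussian,
    ← Complex.exp_add]
  convert h.integral_cexp (star t.fst) (star t.snd) using 1
  · congr 1 with ω
    congr 3
    simp [WithLp.prod_inner_apply, Complex.inner]
  · simp only [norm_star, mul_zero, Complex.zero_re, add_zero, add_div, neg_add,
      Complex.ofReal_add]
    rfl

lemma IsCircularGaussianPair.measureReal_norm_le_of_uncorrelated [IsProbabilityMeasure μ]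
    (h : IsCircularGaussianPair X Y a b 0 μ) (ha : 0 < a) (hb : 0 < b) :
    μ.real {ω | ‖X ω‖ ≤ ‖Y ω‖} = b / (a + b) := by
  lift a to ℝ≥0 using ha.le
  lift b to ℝ≥0 using hb.le
  have hX := h.aemeasurable_fst
  have hY := h.aemeasurable_snd
  have hprob : μ {ω | ‖X ω‖ ≤ ‖Y ω‖} = ENNReal.ofReal (b / (a + b)) := by
    rw [← complexGaussian_prod_norm_le (NNReal.coe_pos.1 ha).ne' (NNReal.coe_pos.1 hb).ne',
      ← h.map_eq_prod, Measure.map_apply_of_aemeasurable (by fun_prop)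
        (measurableSet_le (by fun_prop) (by fun_prop))]
    rfl
  rw [Measure.real, hprob, ENNReal.toReal_ofReal (by positivity)]

lemma norm_add_mul_le_norm_star_mul_add_iff {q : ℂ} (hq : ‖q‖ < 1) (x y : ℂ) :
    ‖x + q * y‖ ≤ ‖star q * x + y‖ ↔ ‖x‖ ≤ ‖y‖ := by
  have hform : ‖x + q * y‖ ^ 2 - ‖star q * x + y‖ ^ 2 =
      (1 - ‖q‖ ^ 2) * (‖x‖ ^ 2 - ‖y‖ ^ 2) := by
    simp only [← Complex.normSq_eq_norm_sq, Complex.normSq_apply]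
    simp
    ring
  have hpos : 0 < 1 - ‖q‖ ^ 2 := by nlinarith [norm_nonneg q]
  rw [← sq_le_sq₀ (norm_nonneg _) (norm_nonneg _), ← sub_nonpos, hform, ← smul_eq_mul,
    smul_nonpos_iff_nonpos_of_pos_left hpos, sub_nonpos, sq_le_sq₀ (norm_nonneg _) (norm_nonneg _)]

lemma exists_quadratic_root_eq_mul_sqrt {σ n : ℝ} (hσ : 0 < σ) (hn : 4 * n < σ ^ 2) :
    ∃ κ > 0, κ ^ 2 * n = κ * σ - 1 ∧ 1 - κ ^ 2 * n = κ * √(σ ^ 2 - 4 * n) := by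
  set D := √(σ ^ 2 - 4 * n)
  have hD : D ^ 2 = σ ^ 2 - 4 * n := Real.sq_sqrt (by linarith)
  have hκ : 2 / (σ + D) * (σ + D) = 2 := div_mul_cancel₀ _ (by positivity)
  have hn4 : n = (σ + D) * (σ - D) / 4 := by linear_combination (1 / 4) * hD
  set κ := 2 / (σ + D)
  have hroot : κ ^ 2 * n = κ * (σ - D) / 2 := by rw [hn4]; linear_combination κ * (σ - D) / 4 * hκ
  exact ⟨κ, by positivity, by linear_combination hroot - hκ / 2,
    by linear_combination -hroot - hκ / 2⟩

lemma IsCircularGaussianPair.hyperbolic_rotation (h : IsCircularGaussianPair X Y a b c μ) (κ : ℝ) :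
    IsCircularGaussianPair (fun ω => X ω + -(κ * c) * Y ω) (fun ω => star (-(κ * c)) * X ω + Y ω)
      (a - 2 * κ * ‖c‖ ^ 2 + κ ^ 2 * ‖c‖ ^ 2 * b) (b - 2 * κ * ‖c‖ ^ 2 + κ ^ 2 * ‖c‖ ^ 2 * a)
      ((1 - κ * (a + b) + κ ^ 2 * ‖c‖ ^ 2 : ℝ) * c) μ := by
  have hcc : (starRingEnd ℂ) c * c = (‖c‖ ^ 2 : ℝ) := by
    rw [Complex.conj_mul', Complex.ofReal_pow]
  have hnorm : ‖(κ * c : ℂ)‖ ^ 2 = κ ^ 2 * ‖c‖ ^ 2 := by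
    rw [norm_mul, Complex.norm_real, mul_pow, Real.norm_eq_abs, sq_abs]
  have hcorr : (star (-(κ * c)) * c).re = -(κ * ‖c‖ ^ 2) := by
    rw [star_neg, star_mul', Complex.star_def, Complex.conj_ofReal, neg_mul, mul_assoc, hcc,
      ← Complex.ofReal_mul, Complex.neg_re, Complex.ofReal_re]
  convert h.linear_combination 1 (-(κ * c)) (star (-(κ * c))) 1 using 1
  · simp only [one_mul]
  · simp only [one_mul]
  · rw [one_mul, hcorr, norm_neg, hnorm, norm_one]
    ring
  · rw [star_one, mul_one, hcorr, norm_star, norm_neg, hnorm, norm_one]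
    ring
  · rw [star_star, star_one]
    simp only [Complex.star_def]
    push_cast at hcc ⊢
    linear_combination (-(κ : ℂ) ^ 2 * c) * hcc

-- The coefficient `-κ c` decorrelates the pair if `κ` is a root of `|c|² κ² - (a + b) κ + 1`; the
-- smaller root makes its modulus less than `1`.
lemma IsCircularGaussianPair.exists_decorrelation (h : IsCircularGaussianPair X Y a b c μ)
    (hab : 0 < a + b) (hc : ‖c‖ ^ 2 < a * b) :
    ∃ κ > 0, ∃ q : ℂ, ‖q‖ < 1 ∧
      IsCircularGaussianPair (fun ω => X ω + q * Y ω) (fun ω => star q * X ω + Y ω)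
        (κ * √((a + b) ^ 2 - 4 * ‖c‖ ^ 2) * (√((a + b) ^ 2 - 4 * ‖c‖ ^ 2) + (a - b)) / 2)
        (κ * √((a + b) ^ 2 - 4 * ‖c‖ ^ 2) * (√((a + b) ^ 2 - 4 * ‖c‖ ^ 2) - (a - b)) / 2) 0 μ := by
  have hdisc : 4 * ‖c‖ ^ 2 < (a + b) ^ 2 := by linarith [sq_nonneg (a - b)]
  obtain ⟨κ, hκ, hroot, hgap⟩ := exists_quadratic_root_eq_mul_sqrt hab hdisc
  set D := √((a + b) ^ 2 - 4 * ‖c‖ ^ 2)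
  have hD : 0 < D := Real.sqrt_pos.2 (by linarith)
  have hD2 : D ^ 2 = (a + b) ^ 2 - 4 * ‖c‖ ^ 2 := Real.sq_sqrt (by linarith)
  refine ⟨κ, hκ, -(κ * c), ?_, ?_⟩
  · rw [norm_neg, ← sq_lt_one_iff₀ (norm_nonneg _), norm_mul, Complex.norm_real, mul_pow,
      Real.norm_eq_abs, sq_abs]
    linarith [mul_pos hκ hD]
  · convert h.hyperbolic_rotation κ using 1
    · linear_combination κ / 2 * hD2 - (a - b) / 2 * hgap - (a + b) / 2 * hroot
    · linear_combination κ / 2 * hD2 + (a - b) / 2 * hgap - (a + b) / 2 * hroot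
    · rw [hroot, sub_add_sub_cancel, sub_self, Complex.ofReal_zero, zero_mul]

theorem IsCircularGaussianPair.measureReal_norm_le [IsProbabilityMeasure μ]
    (h : IsCircularGaussianPair X Y a b c μ) (hab : 0 < a + b) (hc : ‖c‖ ^ 2 < a * b) :
    μ.real {ω | ‖X ω‖ ≤ ‖Y ω‖} = (1 - (a - b) / √((a + b) ^ 2 - 4 * ‖c‖ ^ 2)) / 2 := by
  obtain ⟨κ, hκ, q, hq, hpair⟩ := h.exists_decorrelation hab hc
  set D := √((a + b) ^ 2 - 4 * ‖c‖ ^ 2) with hD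
  have hDab : |a - b| < D := by
    rw [hD]
    refine Real.lt_sqrt_of_sq_lt ?_
    rw [sq_abs]
    linarith
  obtain ⟨hlower, hupper⟩ := abs_lt.1 hDab
  have hD0 : 0 < D := (abs_nonneg _).trans_lt hDab
  have : 0 < D + (a - b) := by linarith
  have : 0 < D - (a - b) := by linarith
  have hevent : {ω | ‖X ω‖ ≤ ‖Y ω‖} = {ω | ‖X ω + q * Y ω‖ ≤ ‖star q * X ω + Y ω‖} :=
    Set.ext fun ω => (norm_add_mul_le_norm_star_mul_add_iff hq (X ω) (Y ω)).symm
  rw [hevent, hpair.measureReal_norm_le_of_uncorrelated (by positivity) (by positivity)]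
  field_simp
  ring

end CircularPair

/-! ### A Gaussian signal observed in white noise -/

section Observation

variable {Ω ι : Type*} [MeasurableSpace Ω] {μ : Measure Ω} {X : Ω → ℂ} {Z : ι → Ω → ℂ} {p v : ℝ≥0}

/-- A complex Gaussian signal `X` of power `p` that is independent of the white complex Gaussian
noise `Z` of power `v`. -/
structure IsSignalInWhiteNoise (X : Ω → ℂ) (Z : ι → Ω → ℂ) (p v : ℝ≥0) (μ : Measure Ω) :
    Prop where
  hasLaw_signal : HasLaw X (complexGaussian p) μ
  hasLaw_noise (i : ι) : HasLaw (Z i) (complexGaussian v) μ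
  iIndepFun_noise : iIndepFun Z μ
  indepFun : IndepFun X (fun ω i => Z i ω) μ

lemma hasLaw_const_mul_complexGaussian (hX : HasLaw X (complexGaussian p) μ) (c : ℂ) :
    HasLaw (fun ω => c * X ω) (complexGaussian (p * ‖c‖₊ ^ 2)) μ :=
  HasLaw.fun_comp (Y := fun z : ℂ => c * z)
    ⟨by fun_prop, complexGaussian_map_const_mul p c⟩ hX

lemma integral_cexp_re_of_hasLaw_complexGaussian (hX : HasLaw X (complexGaussian p) μ) :
    ∫ ω, Complex.exp ((X ω).re * Complex.I) ∂μ = Complex.exp (-(p / 4 : ℝ)) := by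
  have h := charFun_complexGaussian p 1
  rw [← hX.map_eq, charFun_apply, integral_map hX.aemeasurable (by fun_prop)] at h
  simpa [Complex.inner] using h

variable [Fintype ι]

lemma IsSignalInWhiteNoise.hasLaw_linear_combination [IsProbabilityMeasure μ]
    (h : IsSignalInWhiteNoise X Z p v μ) (a : ℂ) (c : ι → ℂ) :
    HasLaw (fun ω => a * X ω + ∑ i, c i * Z i ω)
      (complexGaussian (p * ‖a‖₊ ^ 2 + v * ∑ i, ‖c i‖₊ ^ 2)) μ := by
  have haX := hasLaw_const_mul_complexGaussian h.hasLaw_signal a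
  have hcZ (i : ι) := hasLaw_const_mul_complexGaussian (h.hasLaw_noise i) (c i)
  have hsum : AEMeasurable (fun ω => ∑ i, c i * Z i ω) μ :=
    Finset.aemeasurable_fun_sum _ fun i _ => (hcZ i).aemeasurable
  have hX_sum : IndepFun (fun ω => a * X ω) (fun ω => ∑ i, c i * Z i ω) μ :=
    h.indepFun.comp (φ := fun x => a * x) (ψ := fun z : ι → ℂ => ∑ i, c i * z i)
      (by fun_prop) (by fun_prop)
  have hZ : iIndepFun (fun i ω => c i * Z i ω) μ :=
    h.iIndepFun_noise.comp (fun i z => c i * z) (fun i => by fun_prop)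
  refine ⟨haX.aemeasurable.add hsum, ?_⟩
  have : IsProbabilityMeasure (μ.map (fun ω => a * X ω + ∑ i, c i * Z i ω)) :=
    Measure.isProbabilityMeasure_map (haX.aemeasurable.add hsum)
  refine Measure.ext_of_charFun (funext fun t => ?_)
  rw [hX_sum.charFun_map_fun_add_eq_mul haX.aemeasurable hsum,
    hZ.charFun_map_fun_sum_eq_prod (fun i => (hcZ i).aemeasurable), haX.map_eq]
  simp_rw [(hcZ _).map_eq]
  simp only [Pi.mul_apply, Finset.prod_apply, charFun_complexGaussian]
  rw [← Complex.exp_sum, ← Complex.exp_add]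
  congr 1
  push_cast
  rw [Finset.mul_sum, add_mul, Finset.sum_mul, add_div, Finset.sum_div, neg_add,
    Finset.sum_neg_distrib]

lemma norm_mul_add_mul_sq (s t z w : ℂ) : ‖s * z + t * w‖ ^ 2 =
    ‖z‖ ^ 2 * ‖s‖ ^ 2 + ‖w‖ ^ 2 * ‖t‖ ^ 2 + 2 * (s * star t * (z * star w)).re := by
  simp only [← Complex.normSq_eq_norm_sq, Complex.normSq_apply]
  simp
  ring

lemma IsSignalInWhiteNoise.isCircularGaussianPair [IsProbabilityMeasure μ]
    (h : IsSignalInWhiteNoise X Z p v μ) (a₁ a₂ : ℂ) (c₁ c₂ : ι → ℂ) :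
    IsCircularGaussianPair (fun ω => a₁ * X ω + ∑ i, c₁ i * Z i ω)
      (fun ω => a₂ * X ω + ∑ i, c₂ i * Z i ω)
      (p * ‖a₁‖ ^ 2 + v * ∑ i, ‖c₁ i‖ ^ 2) (p * ‖a₂‖ ^ 2 + v * ∑ i, ‖c₂ i‖ ^ 2)
      (p * (a₁ * star a₂) + v * ∑ i, c₁ i * star (c₂ i)) μ where
  aemeasurable_fst := (h.hasLaw_linear_combination a₁ c₁).aemeasurable
  aemeasurable_snd := (h.hasLaw_linear_combination a₂ c₂).aemeasurable
  integral_cexp s t := by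
    convert integral_cexp_re_of_hasLaw_complexGaussian (h.hasLaw_linear_combination
      (s * a₁ + t * a₂) (fun i => s * c₁ i + t * c₂ i)) using 1
    · congr 1 with ω
      congr 3
      simp only [add_mul, Finset.sum_add_distrib, mul_add, mul_assoc, Finset.mul_sum]
      ring_nf
    · have hcorr : (s * star t * (p * (a₁ * star a₂) + v * ∑ i, c₁ i * star (c₂ i))).re =
          p * (s * star t * (a₁ * star a₂)).re +
            v * ∑ i, (s * star t * (c₁ i * star (c₂ i))).re := by
        rw [← Complex.re_sum, ← Finset.mul_sum, ← Complex.re_ofReal_mul, ← Complex.re_ofReal_mul,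
          ← Complex.add_re]
        congr 1
        ring
      congr 3
      push_cast
      simp only [norm_mul_add_mul_sq, Finset.sum_add_distrib, ← Finset.sum_mul, ← Finset.mul_sum]
      rw [hcorr]
      ring

end Observation

/-! ### The pairwise error probability -/

/-- The probability that an observation of a Gaussian signal at mean signal-to-noise ratio `x` is
not stronger than one of the same signal, in independent noise, at ratio `y`. -/
def pairwiseErrorProb (x y : ℝ) : ℝ :=
  (1 - (x - y) / √((x + y + 2) ^ 2 - 4 * (x * y))) / 2

theorem IsSignalInWhiteNoise.measureReal_norm_le {Ω ι : Type*} [MeasurableSpace Ω] {μ : Measure Ω}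
    [IsProbabilityMeasure μ] [Fintype ι] {X : Ω → ℂ} {Z : ι → Ω → ℂ} {p v : ℝ≥0}
    (h : IsSignalInWhiteNoise X Z p v μ) (hv : v ≠ 0) (a₁ a₂ : ℂ) {c₁ c₂ : ι → ℂ}
    (hc₁ : ∑ i, ‖c₁ i‖ ^ 2 = 1) (hc₂ : ∑ i, ‖c₂ i‖ ^ 2 = 1) (hc : ∑ i, c₁ i * star (c₂ i) = 0) :
    μ.real {ω | ‖a₁ * X ω + ∑ i, c₁ i * Z i ω‖ ≤ ‖a₂ * X ω + ∑ i, c₂ i * Z i ω‖} =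
      pairwiseErrorProb (p * ‖a₁‖ ^ 2 / v) (p * ‖a₂‖ ^ 2 / v) := by
  have hv0 : (0 : ℝ) < v := by positivity
  have hpair := h.isCircularGaussianPair a₁ a₂ c₁ c₂
  rw [hc₁, hc₂, hc, mul_one, mul_zero, add_zero] at hpair
  have hcorr : ‖(p * (a₁ * star a₂) : ℂ)‖ ^ 2 = (p * ‖a₁‖ ^ 2) * (p * ‖a₂‖ ^ 2) := by
    rw [norm_mul, norm_mul, norm_star, Complex.norm_real, NNReal.norm_eq]
    ring
  set x : ℝ := p * ‖a₁‖ ^ 2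
  set y : ℝ := p * ‖a₂‖ ^ 2
  have hx : 0 ≤ x := by positivity
  have hy : 0 ≤ y := by positivity
  have hscale : (x + v + (y + v)) ^ 2 - 4 * (x * y) =
      (v : ℝ) ^ 2 * ((x / v + y / v + 2) ^ 2 - 4 * (x / v * (y / v))) := by
    field_simp
    ring
  rw [hpair.measureReal_norm_le (by positivity) (by rw [hcorr]; nlinarith), hcorr, hscale,
    Real.sqrt_mul (by positivity), Real.sqrt_sq hv0.le, pairwiseErrorProb]
  field_simp
  ring

lemma pairwiseErrorProb_eq (x y : ℝ) :
    pairwiseErrorProb x y = (1 - (x - y) / √((x - y) ^ 2 + 4 * (x + y + 1))) / 2 := by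
  rw [pairwiseErrorProb]
  congr 4
  ring

lemma div_sqrt_sq_add_le_div_sqrt_sq_add {u u' e e' : ℝ} (hu' : 0 ≤ u') (he : 0 < e)
    (he' : 0 < e') (h : u ^ 2 * e' ≤ u' ^ 2 * e) : u / √(u ^ 2 + e) ≤ u' / √(u' ^ 2 + e') := by
  rw [div_le_div_iff₀ (by positivity) (by positivity)]
  refine le_of_sq_le_sq ?_ (by positivity)
  rw [mul_pow, mul_pow, Real.sq_sqrt (by positivity), Real.sq_sqrt (by positivity)]
  linarith

lemma pairwiseErrorProb_nonneg {x y : ℝ} (hx : 0 ≤ x) (hy : 0 ≤ y) : 0 ≤ pairwiseErrorProb x y := by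
  have hle : (x - y) / √((x - y) ^ 2 + 4 * (x + y + 1)) ≤ 1 :=
    div_le_one_of_le₀ (Real.le_sqrt_of_sq_le (by linarith)) (Real.sqrt_nonneg _)
  rw [pairwiseErrorProb_eq]
  linarith

lemma half_le_pairwiseErrorProb {x y : ℝ} (h : x ≤ y) : 1 / 2 ≤ pairwiseErrorProb x y := by
  have hle : (x - y) / √((x + y + 2) ^ 2 - 4 * (x * y)) ≤ 0 :=
    div_nonpos_of_nonpos_of_nonneg (sub_nonpos.2 h) (Real.sqrt_nonneg _)
  rw [pairwiseErrorProb]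
  linarith

lemma pairwiseErrorProb_le_of_le_right {x y y' : ℝ} (hy : 0 ≤ y) (hyy' : y ≤ y') (hy'x : y' ≤ x) :
    pairwiseErrorProb x y ≤ pairwiseErrorProb x y' := by
  have : 0 ≤ x := hy.trans (hyy'.trans hy'x)
  have : 0 ≤ x - y' := sub_nonneg.2 hy'x
  rw [pairwiseErrorProb_eq, pairwiseErrorProb_eq]
  gcongr (1 - ?_) / 2
  exact div_sqrt_sq_add_le_div_sqrt_sq_add (by linarith) (by linarith) (by linarith) (by gcongr)

lemma pairwiseErrorProb_le_of_le_left {x x' r : ℝ} (hx : 0 ≤ x) (hxx' : x ≤ x') (hr : 0 ≤ r)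
    (hr1 : r ≤ 1) : pairwiseErrorProb x' (r * x') ≤ pairwiseErrorProb x (r * x) := by
  have hx' : 0 ≤ x' := hx.trans hxx'
  have hcross : x ^ 2 * (x' + r * x' + 1) ≤ x' ^ 2 * (x + r * x + 1) := by
    have hprod : 0 ≤ x * x' * (1 + r) * (x' - x) := by
      have := sub_nonneg.2 hxx'
      positivity
    have hsq : x ^ 2 ≤ x' ^ 2 := by gcongr
    linarith
  rw [pairwiseErrorProb_eq, pairwiseErrorProb_eq]
  gcongr (1 - ?_) / 2
  refine div_sqrt_sq_add_le_div_sqrt_sq_add ?_ (by positivity) (by positivity) ?_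
  · linarith [mul_le_of_le_one_left hx' hr1]
  · linarith [mul_le_mul_of_nonneg_left hcross (by positivity : 0 ≤ 4 * (1 - r) ^ 2)]

lemma stageTerm_eq (β : ℝ≥0∞) (x : ℝ) :
    stageTerm β x = 2 * pairwiseErrorProb (x / 2) ((β⁻¹).toReal * (x / 2)) := by
  rw [stageTerm, pairwiseErrorProb_eq]
  set r := (β⁻¹).toReal
  have hscale : (x / 2 - r * (x / 2)) ^ 2 + 4 * (x / 2 + r * (x / 2) + 1) =
      2 ^ 2 * (1 + 1 / 2 * (1 + r) * x + 1 / 16 * x ^ 2 * (1 - r) ^ 2) := by ring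
  rw [hscale, Real.sqrt_mul (by positivity), Real.sqrt_sq two_pos.le, ← mul_div_mul_left
    (x / 2 - r * (x / 2)) _ two_ne_zero]
  ring

lemma stageTerm_nonneg (β : ℝ≥0∞) {x : ℝ} (hx : 0 ≤ x) : 0 ≤ stageTerm β x := by
  rw [stageTerm_eq]
  exact mul_nonneg two_pos.le (pairwiseErrorProb_nonneg (by positivity) (by positivity))

lemma one_le_stageTerm {β : ℝ≥0∞} {x : ℝ} (h : x ≤ (β⁻¹).toReal * x) : 1 ≤ stageTerm β x := by
  have hhalf : x / 2 ≤ (β⁻¹).toReal * (x / 2) := by linarith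
  rw [stageTerm_eq]
  linarith [half_le_pairwiseErrorProb hhalf]

lemma toReal_inv_le_one_of_stageTerm_lt_one {β : ℝ≥0∞} {x : ℝ} (hx : 0 ≤ x)
    (h : stageTerm β x < 1) : (β⁻¹).toReal ≤ 1 := by
  by_contra! hβ
  exact h.not_ge (one_le_stageTerm (le_mul_of_one_le_left hx hβ.le))

lemma pairwiseErrorProb_le_stageTerm {β : ℝ≥0∞} {x₀ x y : ℝ} (hx₀ : 0 ≤ x₀) (hx : x₀ / 2 ≤ x)
    (hy : 0 ≤ y) (hβ : (β⁻¹).toReal ≤ 1) (hyx : y ≤ (β⁻¹).toReal * x) :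
    pairwiseErrorProb x y ≤ stageTerm β x₀ / 2 := by
  have hx₀2 : 0 ≤ x₀ / 2 := by positivity
  have hx0 : 0 ≤ x := hx₀2.trans hx
  calc pairwiseErrorProb x y
      ≤ pairwiseErrorProb x ((β⁻¹).toReal * x) :=
        pairwiseErrorProb_le_of_le_right hy hyx (mul_le_of_le_one_left hx0 hβ)
    _ ≤ pairwiseErrorProb (x₀ / 2) ((β⁻¹).toReal * (x₀ / 2)) :=
        pairwiseErrorProb_le_of_le_left hx₀2 hx ENNReal.toReal_nonneg hβ
    _ = stageTerm β x₀ / 2 := by rw [stageTerm_eq, mul_div_cancel_left₀ _ two_ne_zero]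

/-! ### Received signals and gains of beam pairs -/

section Gains

variable {nB nM K S : ℕ}

/-- The response of the beam pair `m` in direction `d`: the product of the projections of its two
beams on the array responses at the grid angles of `d`. -/
def pairResponse (N : ℕ) (aB : ℝ → Fin nB → ℂ) (aM : ℝ → Fin nM → ℂ)
    (F : Codebook nB K S) (W : Codebook nM K S) (s : Fin S) (kB kM : ℕ)
    (m : BeamPair K) (d : Direction N) : ℂ :=
  star (((dictionary N aM)ᴴ * W.mat s kM) d.2 m.2) * ((dictionary N aB)ᴴ * F.mat s kB) d.1 m.1

/-- The channel of the path in direction `d`. -/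
def gridChannel (N : ℕ) (aB : ℝ → Fin nB → ℂ) (aM : ℝ → Fin nM → ℂ) (ρ : ℝ) (α : ℂ)
    (d : Direction N) : Matrix (Fin nM) (Fin nB) ℂ :=
  channel aB aM ρ α (gridAngle N d.1) (gridAngle N d.2)

/-- The coefficients of the noise samples in the measurement of the beam pair `m`. -/
def noiseWeight (W : Codebook nM K S) (s : Fin S) (kM : ℕ) (m : BeamPair K) :
    NoiseIndex S K nM → ℂ :=
  fun j => if j.1 = s ∧ j.2.1 = m.1 ∧ j.2.2.1 = m.2 then star (W.mat s kM j.2.2.2 m.2) else 0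

variable {N : ℕ} {aB : ℝ → Fin nB → ℂ} {aM : ℝ → Fin nM → ℂ}
  {F : Codebook nB K S} {W : Codebook nM K S} {s : Fin S} {kB kM : ℕ}
  {m m' : BeamPair K} {d : Direction N}

lemma norm_jointError_add_mul_jointPattern :
    ‖jointError N aB aM F W s kB kM m d + F.C s * W.C s * jointPattern N K s kB kM m d‖ =
      ‖pairResponse N aB aM F W s kB kM m d‖ := by
  rw [pairResponse, norm_mul, norm_star, ← norm_mul]
  congr 1
  simp only [jointError, jointPattern, errorMatrix, Matrix.add_apply, Matrix.sub_apply,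
    Matrix.kroneckerMap_apply, Matrix.transpose_apply, Matrix.smul_apply, smul_eq_mul]
  ring

lemma sqrt_nominalGain : √(nominalGain F W s) = √(nB * nM) * (F.C s * W.C s) := by
  have hsq : nominalGain F W s = nB * nM * (F.C s * W.C s) ^ 2 := by
    rw [nominalGain]
    ring
  rw [hsq, Real.sqrt_mul (by positivity),
    Real.sqrt_sq (mul_nonneg (F.C_nonneg s) (W.C_nonneg s))]

lemma forwardGain_eq (h : jointPattern N K s kB kM m d = 1) :
    forwardGain N aB aM F W s kB kM m d =
      nB * nM * ‖pairResponse N aB aM F W s kB kM m d‖ ^ 2 := by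
  have hfactor : (√(nominalGain F W s) : ℂ) + √(nB * nM) * jointError N aB aM F W s kB kM m d =
      √(nB * nM) * (jointError N aB aM F W s kB kM m d +
        F.C s * W.C s * jointPattern N K s kB kM m d) := by
    rw [sqrt_nominalGain, h]
    push_cast
    ring
  rw [forwardGain, hfactor, norm_mul, norm_jointError_add_mul_jointPattern, mul_pow,
    Complex.norm_real, Real.norm_eq_abs, sq_abs, Real.sq_sqrt (by positivity)]

lemma backwardGain_eq (h : jointPattern N K s kB kM m d = 0) :
    backwardGain N aB aM F W s kB kM m d =
      nB * nM * ‖pairResponse N aB aM F W s kB kM m d‖ ^ 2 := by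
  rw [backwardGain, ← norm_jointError_add_mul_jointPattern, h, mul_zero, add_zero]

lemma sum_noiseWeight {M : Type*} [AddCommMonoid M] (g : ℂ → NoiseIndex S K nM → M)
    (hg : ∀ j, g 0 j = 0) :
    ∑ j, g (noiseWeight W s kM m j) j = ∑ i, g (star (W.mat s kM i m.2)) (s, m.1, m.2, i) := by
  rw [Fintype.sum_prod_type, Finset.sum_eq_single s, Fintype.sum_prod_type,
    Finset.sum_eq_single m.1, Fintype.sum_prod_type, Finset.sum_eq_single m.2]
  · simp [noiseWeight]
  all_goals simp +contextual [noiseWeight, hg]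

lemma sum_norm_sq_noiseWeight (hk : kM < K ^ (s : ℕ)) :
    ∑ j, ‖noiseWeight W s kM m j‖ ^ 2 = 1 := by
  rw [sum_noiseWeight (fun z _ => ‖z‖ ^ 2) (by simp)]
  simpa only [norm_star] using W.unit_norm s kM m.2 hk

lemma sum_noiseWeight_mul_star (h : m ≠ m') :
    ∑ j, noiseWeight W s kM m j * star (noiseWeight W s kM m' j) = 0 := by
  rw [sum_noiseWeight (fun z j => z * star (noiseWeight W s kM m' j)) (by simp)]
  have hmiss (i : Fin nM) : noiseWeight W s kM m' (s, m.1, m.2, i) = 0 :=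
    if_neg fun hm => h (Prod.ext hm.2.1 hm.2.2)
  simp [hmiss]

lemma conjTranspose_mul_gridChannel_mul (ρ : ℝ) (α : ℂ) :
    ((W.mat s kM)ᴴ * gridChannel N aB aM ρ α d * F.mat s kB) m.2 m.1 =
      √(nB * nM / ρ) * α * pairResponse N aB aM F W s kB kM m d := by
  rw [gridChannel, channel, pairResponse, Matrix.mul_smul, Matrix.smul_mul, Matrix.smul_apply,
    smul_eq_mul, Matrix.mul_vecMulVec, Matrix.vecMulVec_mul, Matrix.vecMulVec_apply]
  congr 2
  simp only [Matrix.mulVec, dotProduct, Matrix.mul_apply, Matrix.conjTranspose_apply, dictionary,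
    Matrix.of_apply, star_sum, star_mul', star_star, mul_comm]

lemma received_gridChannel (P : Fin S → ℝ) (ρ : ℝ) (α : ℂ) (noise : NoiseIndex S K nM → ℂ) :
    received F W P (gridChannel N aB aM ρ α d) noise s kB kM m =
      (√(P s) * √(nB * nM / ρ) * pairResponse N aB aM F W s kB kM m d) * α +
        ∑ j, noiseWeight W s kM m j * noise j := by
  rw [sum_noiseWeight (fun z j => z * noise j) (by simp), received,
    conjTranspose_mul_gridChannel_mul]
  ring

theorem measureReal_norm_received_le {Ω : Type*} [MeasurableSpace Ω] {μ : Measure Ω}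
    [IsProbabilityMeasure μ] {P : Fin S → ℝ} {ρ : ℝ} {PR ν : ℝ≥0} {α : Ω → ℂ}
    {noise : NoiseIndex S K nM → Ω → ℂ} (hsignal : IsSignalInWhiteNoise α noise PR ν μ)
    (hν : ν ≠ 0) (hP : 0 ≤ P s) (hρ : 0 < ρ) (hM : kM < K ^ (s : ℕ))
    (h : jointPattern N K s kB kM m d = 1) (h' : jointPattern N K s kB kM m' d = 0) :
    μ.real {ω |
        ‖received F W P (gridChannel N aB aM ρ (α ω) d) (fun i => noise i ω) s kB kM m‖ ≤
          ‖received F W P (gridChannel N aB aM ρ (α ω) d) (fun i => noise i ω) s kB kM m'‖} =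
      pairwiseErrorProb (P s * forwardGain N aB aM F W s kB kM m d * (PR / (ρ * ν)))
        (P s * backwardGain N aB aM F W s kB kM m' d * (PR / (ρ * ν))) := by
  have hmm' : m ≠ m' := by
    rintro rfl
    exact one_ne_zero (h.symm.trans h')
  have hsnr (z : ℂ) : PR * ‖(√(P s) : ℂ) * √(nB * nM / ρ) * z‖ ^ 2 / ν =
      P s * (nB * nM * ‖z‖ ^ 2) * (PR / (ρ * ν)) := by
    rw [norm_mul, norm_mul, mul_pow, mul_pow, Complex.norm_real, Complex.norm_real,
      Real.norm_eq_abs, Real.norm_eq_abs, sq_abs, sq_abs, Real.sq_sqrt hP,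
      Real.sq_sqrt (by positivity)]
    field_simp
  simp_rw [received_gridChannel]
  rw [hsignal.measureReal_norm_le hν _ _ (sum_norm_sq_noiseWeight hM)
    (sum_norm_sq_noiseWeight hM) (sum_noiseWeight_mul_star hmm'), hsnr, hsnr, forwardGain_eq h,
    backwardGain_eq h']

end Gains

/-! ### Worst-case gains -/

section WorstCase

variable {nB nM K S N : ℕ} {aB : ℝ → Fin nB → ℂ} {aM : ℝ → Fin nM → ℂ}
  {F : Codebook nB K S} {W : Codebook nM K S} {D : Set (Direction N)} {s : Fin S} {kB kM : ℕ}
  {m m' : BeamPair K} {d : Direction N}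

lemma forwardGain_nonneg : 0 ≤ forwardGain N aB aM F W s kB kM m d := sq_nonneg _

lemma backwardGain_nonneg : 0 ≤ backwardGain N aB aM F W s kB kM m d := by
  rw [backwardGain]
  positivity

lemma worstForwardGain_nonneg : 0 ≤ worstForwardGain N aB aM F W D s := by
  refine Real.sInf_nonneg ?_
  rintro _ ⟨_, _, _, _, _, _, _, _, rfl⟩
  exact forwardGain_nonneg

lemma worstForwardGain_le (hB : kB < K ^ (s : ℕ)) (hM : kM < K ^ (s : ℕ)) (hd : d ∈ D)
    (h : jointPattern N K s kB kM m d = 1) :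
    worstForwardGain N aB aM F W D s ≤ forwardGain N aB aM F W s kB kM m d := by
  refine csInf_le ⟨0, ?_⟩ ⟨kB, hB, kM, hM, d, hd, m, h, rfl⟩
  rintro _ ⟨_, _, _, _, _, _, _, _, rfl⟩
  exact forwardGain_nonneg

lemma worstRatio_le (hB : kB < K ^ (s : ℕ)) (hM : kM < K ^ (s : ℕ)) (hd : d ∈ D)
    (h : jointPattern N K s kB kM m d = 1) (h' : jointPattern N K s kB kM m' d = 0) :
    worstRatio N aB aM F W D s ≤ ENNReal.ofReal (forwardGain N aB aM F W s kB kM m d) /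
      ENNReal.ofReal (backwardGain N aB aM F W s kB kM m' d) :=
  sInf_le ⟨kB, hB, kM, hM, d, hd, m, m', h, h', rfl⟩

lemma exists_worstRatio_eq (h : worstRatio N aB aM F W D s ≠ ⊤) :
    ∃ kB < K ^ (s : ℕ), ∃ kM < K ^ (s : ℕ), ∃ d ∈ D, ∃ m m' : BeamPair K,
      jointPattern N K s kB kM m d = 1 ∧ jointPattern N K s kB kM m' d = 0 ∧
      worstRatio N aB aM F W D s = ENNReal.ofReal (forwardGain N aB aM F W s kB kM m d) /
        ENNReal.ofReal (backwardGain N aB aM F W s kB kM m' d) := by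
  rw [worstRatio] at h ⊢
  have hmem := Set.Nonempty.csInf_mem (Set.nonempty_iff_ne_empty.2
    (mt (fun hempty => (congrArg sInf hempty).trans sInf_empty) h))
  refine hmem ((Set.finite_range
    fun q : Fin (K ^ (s : ℕ)) × Fin (K ^ (s : ℕ)) × Direction N × BeamPair K × BeamPair K =>
      ENNReal.ofReal (forwardGain N aB aM F W s q.1 q.2.1 q.2.2.2.1 q.2.2.1) /
        ENNReal.ofReal (backwardGain N aB aM F W s q.1 q.2.1 q.2.2.2.2 q.2.2.1)).subset ?_)
  rintro _ ⟨kB, hB, kM, hM, d, _, m, m', _, _, rfl⟩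
  exact ⟨(⟨kB, hB⟩, ⟨kM, hM⟩, d, m, m'), rfl⟩

lemma worstForwardGain_eq_zero_of_worstRatio_eq_zero (h : worstRatio N aB aM F W D s = 0) :
    worstForwardGain N aB aM F W D s = 0 := by
  obtain ⟨kB, hB, kM, hM, d, hd, m, m', hm, -, hratio⟩ :=
    exists_worstRatio_eq (h.trans_ne ENNReal.zero_ne_top)
  have hzero : ENNReal.ofReal (forwardGain N aB aM F W s kB kM m d) = 0 :=
    (ENNReal.div_eq_zero_iff.1 (hratio.symm.trans h)).resolve_right ENNReal.ofReal_ne_top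
  exact ((worstForwardGain_le hB hM hd hm).trans (ENNReal.ofReal_eq_zero.1 hzero)).antisymm
    worstForwardGain_nonneg

lemma worstRatio_ne_zero_of_stageTerm_lt_one {c γ : ℝ}
    (h : stageTerm (worstRatio N aB aM F W D s) (c * worstForwardGain N aB aM F W D s * γ) < 1) :
    worstRatio N aB aM F W D s ≠ 0 := fun h0 => h.not_ge <| one_le_stageTerm <| by
  rw [worstForwardGain_eq_zero_of_worstRatio_eq_zero h0, mul_zero, zero_mul, mul_zero]

lemma backwardGain_le (h0 : worstRatio N aB aM F W D s ≠ 0) (hB : kB < K ^ (s : ℕ))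
    (hM : kM < K ^ (s : ℕ)) (hd : d ∈ D) (h : jointPattern N K s kB kM m d = 1)
    (h' : jointPattern N K s kB kM m' d = 0) :
    backwardGain N aB aM F W s kB kM m' d ≤
      ((worstRatio N aB aM F W D s)⁻¹).toReal * forwardGain N aB aM F W s kB kM m d := by
  have hinv : (worstRatio N aB aM F W D s)⁻¹ ≠ ⊤ := ENNReal.inv_ne_top.2 h0
  have hle : ENNReal.ofReal (backwardGain N aB aM F W s kB kM m' d) ≤
      (worstRatio N aB aM F W D s)⁻¹ * ENNReal.ofReal (forwardGain N aB aM F W s kB kM m d) := by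
    rw [mul_comm, ← div_eq_mul_inv]
    exact (ENNReal.le_div_iff_mul_le (.inl h0) (.inr ENNReal.ofReal_ne_top)).2
      (ENNReal.mul_le_of_le_div' (worstRatio_le hB hM hd h h'))
  rwa [← ENNReal.toReal_le_toReal ENNReal.ofReal_ne_top
    (ENNReal.mul_ne_top hinv ENNReal.ofReal_ne_top), ENNReal.toReal_mul,
    ENNReal.toReal_ofReal backwardGain_nonneg, ENNReal.toReal_ofReal forwardGain_nonneg] at hle

end WorstCase

/-! ### The path of subsets that leads to the true direction -/

section Path

variable {K S : ℕ}

/-- The subset of level `s` whose range contains the grid point `u`; the search passes through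
these subsets as long as it makes no error. -/
def pathIndex (K S s u : ℕ) : ℕ := u / K ^ (S - s)

/-- The beam of the subset `pathIndex K S s u` whose sub-range contains the grid point `u`. -/
def pathBeam [NeZero K] (S s u : ℕ) : Fin K := Fin.ofNat K (pathIndex K S (s + 1) u)

/-- The beam pair whose main lobe contains the direction `d` when the search has made no error
before stage `s`. -/
def pathPair [NeZero K] (s : Fin S) (d : Direction (K ^ S)) : BeamPair K :=
  (pathBeam S s d.1, pathBeam S s d.2)

lemma pathIndex_zero {u : ℕ} (hu : u < K ^ S) : pathIndex K S 0 u = 0 :=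
  Nat.div_eq_of_lt hu

lemma pathIndex_last (u : ℕ) : pathIndex K S S u = u := by
  rw [pathIndex, Nat.sub_self, pow_zero, Nat.div_one]

lemma pathIndex_lt [NeZero K] {s u : ℕ} (hs : s ≤ S) (hu : u < K ^ S) :
    pathIndex K S s u < K ^ s := by
  rwa [pathIndex, Nat.div_lt_iff_lt_mul (Nat.pow_pos (Nat.pos_of_neZero K)), ← pow_add,
    Nat.add_sub_cancel' hs]

lemma pathIndex_div {s : ℕ} (hs : s < S) (u : ℕ) :
    pathIndex K S (s + 1) u / K = pathIndex K S s u := by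
  have hexp : S - s = S - (s + 1) + 1 := by omega
  rw [pathIndex, pathIndex, hexp, pow_succ, Nat.div_div_eq_div_mul]

lemma mul_pathIndex_add_pathBeam [NeZero K] {s : ℕ} (hs : s < S) (u : ℕ) :
    K * pathIndex K S s u + pathBeam (K := K) S s u = pathIndex K S (s + 1) u := by
  rw [← pathIndex_div hs, pathBeam, Fin.val_ofNat, Nat.div_add_mod]

lemma inSubrange_iff [NeZero K] {s k m u : ℕ} (hs : s < S) :
    InSubrange (K ^ S) K s k m u ↔ pathIndex K S (s + 1) u = K * k + m := by
  have hK := Nat.pos_of_neZero K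
  have hq : 0 < K ^ (S - (s + 1)) := Nat.pow_pos hK
  rw [InSubrange, Nat.pow_div hs hK, pathIndex, Nat.div_eq_iff hq, mul_add_one, mul_comm,
    Nat.succ_eq_add_one]
  omega

lemma inSubrange_pathIndex_iff [NeZero K] {s u : ℕ} (hs : s < S) (m : Fin K) :
    InSubrange (K ^ S) K s (pathIndex K S s u) m u ↔ m = pathBeam S s u := by
  rw [inSubrange_iff hs, ← mul_pathIndex_add_pathBeam hs, Nat.add_left_cancel_iff, Fin.ext_iff,
    eq_comm]

lemma jointPattern_pathIndex [NeZero K] (s : Fin S) (d : Direction (K ^ S)) (m : BeamPair K) :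
    jointPattern (K ^ S) K s (pathIndex K S s d.1) (pathIndex K S s d.2) m d =
      if m = pathPair s d then 1 else 0 := by
  simp only [jointPattern, Matrix.kroneckerMap_apply, Matrix.transpose_apply, patternMatrix,
    Matrix.of_apply, inSubrange_pathIndex_iff s.isLt, pathPair, Prod.ext_iff, ite_and, ite_mul,
    one_mul, zero_mul]

variable {nB nM : ℕ} {sel : (BeamPair K → ℂ) → BeamPair K} {F : Codebook nB K S}
  {W : Codebook nM K S} {P : Fin S → ℝ} {H : Matrix (Fin nM) (Fin nB) ℂ}
  {noise : NoiseIndex S K nM → ℂ}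

lemma search_succ (s : Fin S) :
    search sel F W P H noise s.succ =
      let k := search sel F W P H noise s.castSucc
      let m := sel (received F W P H noise s k.1 k.2)
      (K * k.1 + m.1, K * k.2 + m.2) :=
  Fin.induction_succ ..

variable [NeZero K] {d : Direction (K ^ S)}

lemma search_eq_pathIndex
    (h : ∀ s : Fin S, sel (received F W P H noise s (pathIndex K S s d.1) (pathIndex K S s d.2)) =
      pathPair s d) (i : Fin (S + 1)) :
    search sel F W P H noise i = (pathIndex K S i d.1, pathIndex K S i d.2) := by
  induction i using Fin.induction with
  | zero => exact Prod.ext (pathIndex_zero d.1.isLt).symm (pathIndex_zero d.2.isLt).symm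
  | succ s ih =>
    rw [search_succ, ih]
    simp only [Fin.val_castSucc, h s, Fin.val_succ, pathPair, mul_pathIndex_add_pathBeam s.isLt]

lemma exists_norm_le_of_estimate_ne (hsel : IsArgmaxRule sel)
    (hne : estimate (K ^ S) sel F W P H noise ≠
      (gridAngle (K ^ S) d.1, gridAngle (K ^ S) d.2)) :
    ∃ s, ∃ m ≠ pathPair s d,
      ‖received F W P H noise s (pathIndex K S s d.1) (pathIndex K S s d.2) (pathPair s d)‖ ≤
        ‖received F W P H noise s (pathIndex K S s d.1) (pathIndex K S s d.2) m‖ := by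
  contrapose! hne
  have hcorrect (s : Fin S) :
      sel (received F W P H noise s (pathIndex K S s d.1) (pathIndex K S s d.2)) =
        pathPair s d := by
    by_contra hwrong
    exact (hne s _ hwrong).not_ge (le_of_sq_le_sq (hsel _ _) (norm_nonneg _))
  rw [estimate, search_eq_pathIndex hcorrect, Fin.val_last, pathIndex_last, pathIndex_last]

end Path

/-! ### The error probability -/

section ErrorProbability

variable {K S : ℕ} {P : Fin S → ℝ} {γ : ℝ} {β : Fin S → ℝ≥0∞} {G : Fin S → ℝ}

lemma one_le_errorBound (hK : 2 ≤ K) (hx : ∀ s, 0 ≤ P s * G s * γ)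
    (h : ∃ s, 1 ≤ stageTerm (β s) (P s * G s * γ)) : 1 ≤ errorBound K P γ β G := by
  obtain ⟨s, hs⟩ := h
  have hsum : 1 ≤ ∑ s, stageTerm (β s) (P s * G s * γ) :=
    hs.trans (Finset.single_le_sum (f := fun s => stageTerm (β s) (P s * G s * γ))
      (fun s _ => stageTerm_nonneg _ (hx s)) (Finset.mem_univ s))
  have hcard : (1 : ℝ) ≤ ((K : ℝ) ^ 2 - 1) / 2 := by
    have hK2 : (2 : ℝ) ≤ K := by exact_mod_cast hK
    have hsq : (2 : ℝ) ^ 2 ≤ (K : ℝ) ^ 2 := by gcongr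
    linarith
  exact one_le_mul_of_one_le_of_one_le hcard hsum

lemma card_erase_beamPair [NeZero K] (m : BeamPair K) :
    ((Finset.univ.erase m).card : ℝ) = (K : ℝ) ^ 2 - 1 := by
  rw [Finset.card_erase_of_mem (Finset.mem_univ m), Finset.card_univ, Fintype.card_prod,
    Fintype.card_fin, Nat.cast_sub (Nat.mul_pos K.pos_of_neZero K.pos_of_neZero)]
  push_cast
  ring

variable {nB nM : ℕ} {aB : ℝ → Fin nB → ℂ} {aM : ℝ → Fin nM → ℂ} {F : Codebook nB K S}
  {W : Codebook nM K S} {D : Set (Direction (K ^ S))} {d : Direction (K ^ S)} {ρ σ : ℝ}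
  {PR ν : ℝ≥0} {Ω : Type*} [MeasurableSpace Ω] {μ : Measure Ω} [IsProbabilityMeasure μ]
  {α : Ω → ℂ} {noise : NoiseIndex S K nM → Ω → ℂ} [NeZero K]

/-- The event that the beam pair `m` receives at least as much power at stage `s` as the pair
whose main lobe contains the true direction `d`, when the search has made no error before. -/
def pairwiseErrorEvent (aB : ℝ → Fin nB → ℂ) (aM : ℝ → Fin nM → ℂ) (F : Codebook nB K S)
    (W : Codebook nM K S) (P : Fin S → ℝ) (ρ : ℝ) (α : Ω → ℂ) (noise : NoiseIndex S K nM → Ω → ℂ)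
    (d : Direction (K ^ S)) (s : Fin S) (m : BeamPair K) : Set Ω :=
  {ω | ‖received F W P (gridChannel (K ^ S) aB aM ρ (α ω) d) (fun i => noise i ω) s
      (pathIndex K S s d.1) (pathIndex K S s d.2) (pathPair s d)‖ ≤
    ‖received F W P (gridChannel (K ^ S) aB aM ρ (α ω) d) (fun i => noise i ω) s
      (pathIndex K S s d.1) (pathIndex K S s d.2) m‖}

lemma measureReal_estimate_ne_le_sum {sel : (BeamPair K → ℂ) → BeamPair K}
    (hsel : IsArgmaxRule sel) :
    μ.real {ω | estimate (K ^ S) sel F W P (gridChannel (K ^ S) aB aM ρ (α ω) d)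
        (fun i => noise i ω) ≠ (gridAngle (K ^ S) d.1, gridAngle (K ^ S) d.2)} ≤
      ∑ s, ∑ m ∈ Finset.univ.erase (pathPair s d),
        μ.real (pairwiseErrorEvent aB aM F W P ρ α noise d s m) := by
  have hsub : {ω | estimate (K ^ S) sel F W P (gridChannel (K ^ S) aB aM ρ (α ω) d)
        (fun i => noise i ω) ≠ (gridAngle (K ^ S) d.1, gridAngle (K ^ S) d.2)} ⊆
      ⋃ s ∈ Finset.univ, ⋃ m ∈ Finset.univ.erase (pathPair s d),
        pairwiseErrorEvent aB aM F W P ρ α noise d s m := by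
    intro ω hω
    obtain ⟨s, m, hm, hle⟩ := exists_norm_le_of_estimate_ne hsel hω
    exact Set.mem_biUnion (Finset.mem_univ s)
      (Set.mem_biUnion (Finset.mem_erase.2 ⟨hm, Finset.mem_univ m⟩) hle)
  calc _ ≤ _ := measureReal_mono hsub (measure_ne_top _ _)
    _ ≤ _ := measureReal_biUnion_finset_le _ _
    _ ≤ _ := Finset.sum_le_sum fun s _ => measureReal_biUnion_finset_le _ _

lemma half_div_mul_sq_le_div_mul {p ρ σ v : ℝ} (hp : 0 ≤ p) (hρ : 0 < ρ) (hv : 0 < v)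
    (hvσ : v ≤ 2 * σ ^ 2) : p / (ρ * σ ^ 2) / 2 ≤ p / (ρ * v) := by
  rw [div_div]
  exact div_le_div_of_nonneg_left hp (by positivity)
    (by linarith [mul_le_mul_of_nonneg_left hvσ hρ.le])

lemma measureReal_pairwiseErrorEvent_le (hsignal : IsSignalInWhiteNoise α noise PR ν μ)
    (hν : ν ≠ 0) (hνσ : ν ≤ 2 * σ ^ 2) (hρ : 0 < ρ) (hd : d ∈ D) {s : Fin S} (hP : 0 ≤ P s)
    {m : BeamPair K} (hm : m ≠ pathPair s d)
    (hlt : stageTerm (worstRatio (K ^ S) aB aM F W D s)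
      (P s * worstForwardGain (K ^ S) aB aM F W D s * (PR / (ρ * σ ^ 2))) < 1) :
    μ.real (pairwiseErrorEvent aB aM F W P ρ α noise d s m) ≤
      stageTerm (worstRatio (K ^ S) aB aM F W D s)
        (P s * worstForwardGain (K ^ S) aB aM F W D s * (PR / (ρ * σ ^ 2))) / 2 := by
  have hB := pathIndex_lt s.isLt.le d.1.isLt
  have hM := pathIndex_lt s.isLt.le d.2.isLt
  have hmain := (jointPattern_pathIndex s d (pathPair s d)).trans (if_pos rfl)
  have hmiss := (jointPattern_pathIndex s d m).trans (if_neg hm)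
  have hx : 0 ≤ P s * worstForwardGain (K ^ S) aB aM F W D s * (PR / (ρ * σ ^ 2)) :=
    mul_nonneg (mul_nonneg hP worstForwardGain_nonneg) (by positivity)
  have hβ := worstRatio_ne_zero_of_stageTerm_lt_one hlt
  rw [pairwiseErrorEvent, measureReal_norm_received_le hsignal hν hP hρ hM hmain hmiss]
  refine pairwiseErrorProb_le_stageTerm hx ?_
    (mul_nonneg (mul_nonneg hP backwardGain_nonneg) (by positivity))
    (toReal_inv_le_one_of_stageTerm_lt_one hx hlt) ?_
  · rw [mul_div_assoc]
    exact mul_le_mul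
      (mul_le_mul_of_nonneg_left (worstForwardGain_le hB hM hd hmain) hP)
      (half_div_mul_sq_le_div_mul PR.coe_nonneg hρ (by positivity) hνσ) (by positivity)
      (mul_nonneg hP forwardGain_nonneg)
  · rw [← mul_assoc, mul_left_comm]
    gcongr
    exact backwardGain_le hβ hB hM hd hmain hmiss

end ErrorProbability

end MmWave

end

open MmWave in
theorem theorem1_general {Ω : Type*} [MeasurableSpace Ω] (μ : Measure Ω) [IsProbabilityMeasure μ]
    {nB nM K S : ℕ} (hK : 2 ≤ K) (aB : ℝ → Fin nB → ℂ) (aM : ℝ → Fin nM → ℂ)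
    (F : Codebook nB K S) (W : Codebook nM K S)
    (sel : (BeamPair K → ℂ) → BeamPair K) (hsel : IsArgmaxRule sel)
    (P : Fin S → ℝ) (hP : ∀ s, 0 ≤ P s) (ρ : ℝ) (hρ : 0 < ρ) (PR : ℝ≥0)
    (σ : ℝ) (ν : ℝ≥0) (hν : ν ≠ 0) (hνσ : (ν : ℝ) ≤ 2 * σ ^ 2)
    (α : Ω → ℂ) (noise : NoiseIndex S K nM → Ω → ℂ)
    (hsignal : IsSignalInWhiteNoise α noise PR ν μ)
    (d : Direction (K ^ S)) (D : Set (Direction (K ^ S))) (hd : d ∈ D) :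
    μ.real {ω | estimate (K ^ S) sel F W P (gridChannel (K ^ S) aB aM ρ (α ω) d)
        (fun i => noise i ω) ≠ (gridAngle (K ^ S) d.1, gridAngle (K ^ S) d.2)} ≤
      errorBound K P (PR / (ρ * σ ^ 2)) (worstRatio (K ^ S) aB aM F W D)
        (worstForwardGain (K ^ S) aB aM F W D) := by
  have : NeZero K := ⟨by omega⟩
  let x (s : Fin S) := P s * worstForwardGain (K ^ S) aB aM F W D s * (PR / (ρ * σ ^ 2))
  by_cases! htrivial : ∃ s, 1 ≤ stageTerm (worstRatio (K ^ S) aB aM F W D s) (x s)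
  · have hx (s : Fin S) : 0 ≤ x s :=
      mul_nonneg (mul_nonneg (hP s) worstForwardGain_nonneg) (by positivity)
    exact measureReal_le_one.trans (one_le_errorBound hK hx htrivial)
  · calc _ ≤ ∑ s, ∑ m ∈ Finset.univ.erase (pathPair s d),
          μ.real (pairwiseErrorEvent aB aM F W P ρ α noise d s m) :=
          measureReal_estimate_ne_le_sum hsel
      _ ≤ ∑ s, ∑ m ∈ Finset.univ.erase (pathPair s d),
          stageTerm (worstRatio (K ^ S) aB aM F W D s) (x s) / 2 :=
          Finset.sum_le_sum fun s _ => Finset.sum_le_sum fun m hm =>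
            measureReal_pairwiseErrorEvent_le hsignal hν hνσ hρ hd (hP s)
              (Finset.ne_of_mem_erase hm) (htrivial s)
      _ = _ := by
          simp only [Finset.sum_const, nsmul_eq_mul, card_erase_beamPair, errorBound,
            Finset.mul_sum, mul_div_assoc', mul_div_right_comm, x]

theorem theorem1 {Ω : Type*} [MeasurableSpace Ω] (μ : MeasureTheory.Measure Ω)
    [MeasureTheory.IsProbabilityMeasure μ]
    (nB nM K S N : ℕ) (hK : 2 ≤ K) (hN : N = K ^ S)
    -- antenna arrays, codebooks, selection rule
    (aB : ℝ → Fin nB → ℂ) (aM : ℝ → Fin nM → ℂ)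
    (F : MmWave.Codebook nB K S) (W : MmWave.Codebook nM K S)
    (sel : (MmWave.BeamPair K → ℂ) → MmWave.BeamPair K) (hsel : MmWave.IsArgmaxRule sel)
    -- training powers, path loss, mean path power, noise level
    (P : Fin S → ℝ) (hP : ∀ s, 0 ≤ P s) (ρ : ℝ) (hρ : 0 < ρ) (PR : NNReal)
    (σ : ℝ) (hσ : 0 < σ)
    -- mean noise power: both conventions for a complex Gaussian of variance `σ²`
    (ν : NNReal) (hν : (ν : ℝ) = σ ^ 2 ∨ (ν : ℝ) = 2 * σ ^ 2)
    -- path gain and noise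
    (α : Ω → ℂ) (noise : MmWave.NoiseIndex S K nM → Ω → ℂ)
    (hα : ProbabilityTheory.HasLaw α (MmWave.complexGaussian PR) μ)
    (hnoise : ∀ i, ProbabilityTheory.HasLaw (noise i) (MmWave.complexGaussian ν) μ)
    (hindep : ProbabilityTheory.iIndepFun noise μ)
    (hαnoise : ProbabilityTheory.IndepFun α (fun ω i => noise i ω) μ)
    -- the true direction
    (d : MmWave.Direction N) :
    let φ := MmWave.gridAngle N d.1
    let θ := MmWave.gridAngle N d.2
    let γ := (PR : ℝ) / (ρ * σ ^ 2)
    let p := μ.real {ω | MmWave.estimate N sel F W P (MmWave.channel aB aM ρ (α ω) φ θ)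
      (fun i => noise i ω) ≠ (φ, θ)}
    p ≤ MmWave.errorBound K P γ (MmWave.worstRatio N aB aM F W Set.univ)
        (MmWave.worstForwardGain N aB aM F W Set.univ) ∧
      p ≤ MmWave.errorBound K P γ (MmWave.worstRatio N aB aM F W {d})
        (MmWave.worstForwardGain N aB aM F W {d}) := by
  subst hN
  have hσ2 : 0 < σ ^ 2 := by positivity
  have hν0 : ν ≠ 0 := NNReal.coe_ne_zero.1 (by rcases hν with h | h <;> linarith)
  have hνσ : (ν : ℝ) ≤ 2 * σ ^ 2 := by rcases hν with h | h <;> linarith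
  have hle := theorem1_general μ hK aB aM F W sel hsel P hP ρ hρ PR σ ν hν0 hνσ α noise
    ⟨hα, hnoise, hindep, hαnoise⟩ d
  exact ⟨hle Set.univ (Set.mem_univ d), hle {d} (Set.mem_singleton d)⟩
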